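/- All graphs are finite and simple. Let $G$ be a graph and $f:V(G)\to\mathbb{N}$. The on-line $f$-list colouring game on $G$ is played by Alice and Bob, starting with all vertices uncoloured. In the $i$-th round Alice marks a nonempty set $V_i$ of uncoloured vertices, and Bob then chooses an independent set $X_i\subseteq V_i$ and colours all vertices of $X_i$ with colour $i$. Alice wins if at some time (including the start of the game) there is an uncoloured vertex $v$ that has been marked $f(v)$ times; otherwise Bob wins, i.e. every vertex $v$ is coloured by Bob no later than the $f(v)$-th time it is marked. The graph $G$ is on-line $f$-choosable if Bob has a winning strategy, and on-line $k$-choosable if this holds for the constant function $f=k$. The on-line choice number $\chi_p(G)$ is the least $k$ such that $G$ is on-line $k$-choosable, and $G$ is called on-line chromatic-choosable if $\chi_p(G)=\chi(G)$, where $\chi(G)$ is the chromatic number. **Theorem.** Let $G$ be a complete multipartite graph with independence number $m\ge 2$, and for $1\le p\le m$ let $k_p$ be the number of parts of $G$ of cardinality $p$. If $$k_1-\sum_{p=2}^m\left(\frac{p^2}{2}-\frac{3p}{2}+1\right)k_p\ \ge\ 0,$$ then $G$ is on-line chromatic-choosable, that is, $\chi_p(G)=\chi(G)$. -/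

import Mathlib

/-!
# The on-line list colouring game and the on-line choice number

A play is recorded by the list of the sets marked by Alice, most recent round first.  Since the
rounds are `1, 2, …`, the colour of a round is its number, and need not be recorded.
-/

namespace OnlineColoring

section Game

variable {V : Type*} [Fintype V] [DecidableEq V]

/-- A strategy for Bob: from the sets marked by Alice so far (the head of the list is the set
marked in the current round), the set of vertices that Bob colours in the current round. -/
abbrev Strategy (V : Type*) := List (Finset V) → Finset V

/-- The set of vertices that are still uncoloured after the rounds `h`, if Bob follows `σ`. -/
def uncolored (σ : Strategy V) : List (Finset V) → Finset V
  | [] => Finset.univ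
  | U :: h => uncolored σ h \ σ (U :: h)

/-- In every round of `h`, Alice has marked a nonempty set of vertices that were still uncoloured
(where Bob follows `σ`). -/
def AliceLegal (σ : Strategy V) : List (Finset V) → Prop
  | [] => True
  | U :: h => AliceLegal σ h ∧ U.Nonempty ∧ U ⊆ uncolored σ h

/-- How many times the vertex `v` has been marked, i.e. its number of permissible colours. -/
def timesMarked (v : V) (h : List (Finset V)) : ℕ :=
  h.countP (fun U => v ∈ U)

/-- `σ` is a winning strategy for Bob in the on-line `f`-list colouring game on `G`: however Alice
plays, Bob always answers a marked set `U` by an independent set contained in `U`, and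
there is never a vertex `v` that has been marked `f v` times and is still uncoloured. -/
def IsWinning (G : SimpleGraph V) (f : V → ℕ) (σ : Strategy V) : Prop :=
  (∀ (U : Finset V) (h : List (Finset V)), AliceLegal σ (U :: h) →
    σ (U :: h) ⊆ U ∧ G.IsIndepSet (σ (U :: h) : Set V)) ∧
  (∀ h : List (Finset V), AliceLegal σ h → ∀ v ∈ uncolored σ h, timesMarked v h < f v)

/-- `G` is on-line `f`-choosable: Bob has a winning strategy. -/
def OnlineChoosable (G : SimpleGraph V) (f : V → ℕ) : Prop :=
  ∃ σ : Strategy V, IsWinning G f σ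

/-- The on-line choice number `χ_p(G)`: the least `k` such that `G` is on-line `k`-choosable (as
an element of `ℕ∞`, like `SimpleGraph.chromaticNumber`). -/
noncomputable def onlineChoiceNumber (G : SimpleGraph V) : ℕ∞ :=
  ⨅ k ∈ {k : ℕ | OnlineChoosable G (fun _ => k)}, (k : ℕ∞)

/-- `G` is on-line chromatic-choosable: `χ_p(G) = χ(G)`. -/
def OnlineChromaticChoosable (G : SimpleGraph V) : Prop :=
  onlineChoiceNumber G = G.chromaticNumber

end Game

/-- The number `k_p` of parts of cardinality `p` of a complete multipartite graph; the parts are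
the classes of the equivalence relation of non-adjacency. -/
noncomputable def numParts {V : Type*} {G : SimpleGraph V} (hG : G.IsCompleteMultipartite)
    (p : ℕ) : ℕ :=
  {X : Set V | X ∈ hG.setoid.classes ∧ X.ncard = p}.ncard

end OnlineColoring

/-!
# On-line chromatic-choosability of complete multipartite graphs with many singleton parts
-/

/-! One vertex from each part gives a clique, so χ(G) is at least the number K of parts. Since
χ_p(G) ≥ χ(G) always holds, it suffices that Bob wins with K tokens per vertex, a token being spent
at each marking.

Bob keeps some independent parts `𝓟` and a set `S` of single vertices, ordered by decreasing class
and then by increasing rank. The invariant `Safe` gives each j-subset of a part at least `demand` j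
tokens, and each single vertex of class c at least `width` c plus its place in the order. Each reply
must make these bounds fall as fast as tokens are spent.

A fully marked part is coloured whole. Otherwise, call a marked subset of a part tight if it has
exactly `demand` many tokens. Adding an unmarked vertex w of the part to a tight set shows that w
owns a full increment `slope` of `demand`, which is what w needs to become single. Without tight
sets, every marked subset of a part has a token to spare. Then Bob colours the first marked single
vertex if its class is at least the number of marked vertices in every part, and otherwise the
marked vertices of a part having most of them.

At the start, the excess of max(p - i, 1) over 1, summed over i ≥ 1, is at most (p - 1)(p - 2)/2,
the coefficient in the hypothesis. So k_1 absorbs all excesses, and `demand` j ≤ jK. -/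

namespace OnlineColoring

/-! ### Positional strategies, and χ ≤ χ_p. -/

section Strategy

variable {V : Type*} [DecidableEq V]

/-- The remaining tokens after the vertices of `U` have been marked. -/
def spend (g : V → ℤ) (U : Finset V) (v : V) : ℤ := g v - if v ∈ U then 1 else 0

theorem sum_spend (g : V → ℤ) (U T : Finset V) :
    ∑ v ∈ T, spend g U v = ∑ v ∈ T, g v - ((T ∩ U).card : ℤ) := by
  simp [spend, Finset.sum_sub_distrib, Finset.sum_ite_mem]

theorem spend_of_notMem {g : V → ℤ} {U : Finset V} {v : V} (hv : v ∉ U) : spend g U v = g v := by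
  simp [spend, hv]

theorem le_spend (g : V → ℤ) (U : Finset V) (v : V) : g v - 1 ≤ spend g U v := by
  unfold spend; split_ifs <;> omega

/-- The tokens left after the rounds `h`. -/
def tokens (f : V → ℕ) (h : List (Finset V)) (v : V) : ℤ := (f v : ℤ) - timesMarked v h

theorem tokens_cons (f : V → ℕ) (U : Finset V) (h : List (Finset V)) :
    tokens f (U :: h) = spend (tokens f h) U := by
  funext v
  simp only [tokens, spend, timesMarked, List.countP_cons, decide_eq_true_eq]
  split_ifs <;> push_cast <;> ring

variable [Fintype V]

/-- The uncoloured vertices if Bob answers a marked set by `r`, a function of the uncoloured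
vertices, the remaining tokens, and the marked set. -/
def remaining (r : Finset V → (V → ℤ) → Finset V → Finset V) (f : V → ℕ) :
    List (Finset V) → Finset V
  | [] => Finset.univ
  | U :: h => remaining r f h \ r (remaining r f h) (tokens f h) U

/-- The strategy that answers according to `r`. -/
def positional (r : Finset V → (V → ℤ) → Finset V → Finset V) (f : V → ℕ) : Strategy V
  | [] => ∅
  | U :: h => r (remaining r f h) (tokens f h) U

theorem uncolored_positional (r : Finset V → (V → ℤ) → Finset V → Finset V) (f : V → ℕ)
    (h : List (Finset V)) : uncolored (positional r f) h = remaining r f h := by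
  induction h with
  | nil => rfl
  | cons U h ih => simp [uncolored, remaining, positional, ih]

/-- Bob wins if he can maintain an invariant which guarantees a token to each uncoloured vertex. -/
theorem onlineChoosable_of_invariant {G : SimpleGraph V} {f : V → ℕ}
    (I : Finset V → (V → ℤ) → Prop) (hinit : I Finset.univ (fun v => f v))
    (hpos : ∀ X g, I X g → ∀ v ∈ X, 0 < g v)
    (hstep : ∀ X g U, I X g →
      ∃ Y : Finset V, Y ⊆ U ∧ G.IsIndepSet (Y : Set V) ∧ I (X \ Y) (spend g U)) :
    OnlineChoosable G f := by
  classical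
  choose! r hr using hstep
  have key : ∀ h, I (remaining r f h) (tokens f h) := by
    intro h
    induction h with
    | nil =>
      have : tokens f [] = fun v => (f v : ℤ) := by funext v; simp [tokens, timesMarked]
      rw [this]
      exact hinit
    | cons U h ih =>
      rw [tokens_cons]
      exact (hr _ _ U ih).2.2
  refine ⟨positional r f, fun U h _ => ?_, fun h _ v hv => ?_⟩
  · exact ⟨(hr _ _ U (key h)).1, (hr _ _ U (key h)).2.1⟩
  · rw [uncolored_positional] at hv
    have := hpos _ _ (key h) v hv
    simp only [tokens] at this
    omega

/-- If Alice marks all uncoloured vertices in each round, Bob ends up with a proper colouring. -/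
theorem OnlineChoosable.colorable {G : SimpleGraph V} {k : ℕ}
    (hG : OnlineChoosable G (fun _ => k)) : G.Colorable k := by
  obtain ⟨σ, hσ, hwin⟩ := hG
  have key : ∀ n : ℕ, ∃ h, AliceLegal σ h ∧ (∀ v ∈ uncolored σ h, timesMarked v h = n) ∧
      ∃ c : V → ℕ, (∀ v, v ∉ uncolored σ h → c v < n) ∧
        ∀ v w, v ∉ uncolored σ h → w ∉ uncolored σ h → G.Adj v w → c v ≠ c w := by
    intro n
    induction n with
    | zero => exact ⟨[], trivial, by simp [timesMarked], fun _ => 0, by simp [uncolored]⟩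
    | succ n ih =>
      obtain ⟨h, hl, hm, c, hc, hp⟩ := ih
      rcases (uncolored σ h).eq_empty_or_nonempty with he | hne
      -- With everything coloured Alice has no legal move; the play is kept and the claim on
      -- markings is vacuous.
      · exact ⟨h, hl, by simp [he], c, fun v hv => (hc v hv).trans (Nat.lt_succ_self n), hp⟩
      · have hl' : AliceLegal σ (uncolored σ h :: h) := ⟨hl, hne, Finset.Subset.refl _⟩
        obtain ⟨-, hi⟩ := hσ _ _ hl'
        refine ⟨uncolored σ h :: h, hl', fun v hv => ?_,
          fun v => if v ∈ uncolored σ h then n else c v, fun v _ => ?_, fun v w hv hw hvw => ?_⟩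
        · have hv' : v ∈ uncolored σ h := (Finset.mem_sdiff.1 hv).1
          have := hm v hv'
          simp only [timesMarked] at this ⊢
          simp [hv', this]
        · dsimp only
          split_ifs with hv
          · exact Nat.lt_succ_self n
          · exact (hc v hv).trans (Nat.lt_succ_self n)
        · simp only [uncolored, Finset.mem_sdiff, not_and, not_not] at hv hw
          dsimp only
          split_ifs with h1 h2 h2
          · exact absurd hvw (hi (Finset.mem_coe.2 (hv h1)) (Finset.mem_coe.2 (hw h2)) hvw.ne)
          · exact (hc w h2).ne'
          · exact (hc v h1).ne
          · exact hp v w h1 h2 hvw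
  obtain ⟨h, hl, hm, c, hc, hp⟩ := key k
  have hall : ∀ v, v ∉ uncolored σ h := fun v hv => (hwin h hl v hv).ne (hm v hv)
  exact ⟨SimpleGraph.Coloring.mk (fun v => (⟨c v, hc v (hall v)⟩ : Fin k))
    fun {v w} hvw he => hp v w (hall v) (hall w) hvw (congrArg Fin.val he)⟩

end Strategy

/-! ### The invariant and its arithmetic. -/

section Position

variable {V : Type*}

/-- A part `P` counts `max (|P| - i) 1` times. -/
def width (𝓟 : Finset (Finset V)) (i : ℕ) : ℤ := ∑ P ∈ 𝓟, max ((P.card : ℤ) - i) 1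

/-- The number of single vertices of class at least `i`; an entry `(v, c, r)` is the vertex `v`
with class `c` and rank `r`. -/
def countAbove (S : Finset (V × ℕ × ℕ)) (i : ℕ) : ℤ := ((S.filter fun s => i ≤ s.2.1).card : ℤ)

/-- The number of single vertices which Bob prefers to `s` or treats like `s`. -/
def countBefore (S : Finset (V × ℕ × ℕ)) (s : V × ℕ × ℕ) : ℤ :=
  ((S.filter fun s' => s.2.1 < s'.2.1 ∨ s'.2.1 = s.2.1 ∧ s'.2.2 ≤ s.2.2).card : ℤ)

/-- The increment of `demand` from `i` to `i + 1`. -/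
def slope (𝓟 : Finset (Finset V)) (S : Finset (V × ℕ × ℕ)) (i : ℕ) : ℤ :=
  width 𝓟 i + countAbove S i

/-- The number of tokens that `j` vertices of a part should have in total. -/
def demand (𝓟 : Finset (Finset V)) (S : Finset (V × ℕ × ℕ)) (j : ℕ) : ℤ :=
  (𝓟.card : ℤ) + ∑ i ∈ Finset.Ico 1 j, slope 𝓟 S i

/-- Bob's invariant: the uncoloured vertices `X` are covered by independent parts `𝓟` and single
vertices `S` which have sufficiently many tokens `g`. -/
structure Safe (G : SimpleGraph V) (𝓟 : Finset (Finset V)) (S : Finset (V × ℕ × ℕ))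
    (X : Finset V) (g : V → ℤ) : Prop where
  cover : ∀ v ∈ X, (∃ P ∈ 𝓟, v ∈ P) ∨ ∃ s ∈ S, s.1 = v
  indep : ∀ P ∈ 𝓟, G.IsIndepSet (P : Set V)
  part : ∀ P ∈ 𝓟, ∀ T ⊆ P, T.Nonempty → demand 𝓟 S T.card ≤ ∑ v ∈ T, g v
  single : ∀ s ∈ S, width 𝓟 s.2.1 + countBefore S s ≤ g s.1

theorem width_nonneg (𝓟 : Finset (Finset V)) (i : ℕ) : 0 ≤ width 𝓟 i :=
  Finset.sum_nonneg fun _ _ => zero_le_one.trans (le_max_right _ _)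

theorem width_eq_card {𝓟 : Finset (Finset V)} {i : ℕ} (h : ∀ P ∈ 𝓟, P.card ≤ i + 1) :
    width 𝓟 i = 𝓟.card := by
  unfold width
  rw [Finset.sum_congr rfl (fun P hP => max_eq_right (by have := h P hP; omega))]
  simp

theorem countBefore_pos {S : Finset (V × ℕ × ℕ)} {s : V × ℕ × ℕ} (hs : s ∈ S) :
    0 < countBefore S s := by
  unfold countBefore
  exact_mod_cast Finset.card_pos.2 ⟨s, by simp [hs]⟩

theorem countBefore_le_countAbove (S : Finset (V × ℕ × ℕ)) (s : V × ℕ × ℕ) :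
    countBefore S s ≤ countAbove S s.2.1 := by
  unfold countBefore countAbove
  exact_mod_cast Finset.card_le_card (Finset.monotone_filter_right S (fun s' _ h => by omega))

/-- Thus `demand` is concave in the size; this transfers a bound from a tight set to the possibly
larger set of all marked vertices of its part. -/
theorem slope_antitone (𝓟 : Finset (Finset V)) (S : Finset (V × ℕ × ℕ)) {i j : ℕ} (h : i ≤ j) :
    slope 𝓟 S j ≤ slope 𝓟 S i := by
  unfold slope width countAbove
  refine add_le_add (Finset.sum_le_sum fun P _ => max_le_max (by omega) le_rfl) ?_
  exact_mod_cast Finset.card_le_card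
    (Finset.monotone_filter_right S (fun s' _ h' => by omega))

theorem demand_one (𝓟 : Finset (Finset V)) (S : Finset (V × ℕ × ℕ)) :
    demand 𝓟 S 1 = 𝓟.card := by simp [demand]

theorem demand_succ (𝓟 : Finset (Finset V)) (S : Finset (V × ℕ × ℕ)) {j : ℕ} (hj : 1 ≤ j) :
    demand 𝓟 S (j + 1) = demand 𝓟 S j + slope 𝓟 S j := by
  simp only [demand, Finset.sum_Ico_succ_top hj, add_assoc]

/-- The loss of `demand` is at least the loss of its increments. -/
theorem demand_add_le {𝓟 𝓟' : Finset (Finset V)} {S S' : Finset (V × ℕ × ℕ)} {a : ℤ} {b : ℕ → ℤ}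
    (hc : (𝓟'.card : ℤ) + a ≤ 𝓟.card)
    (hs : ∀ i, 1 ≤ i → slope 𝓟' S' i + b i ≤ slope 𝓟 S i) (j : ℕ) :
    demand 𝓟' S' j + a + ∑ i ∈ Finset.Ico 1 j, b i ≤ demand 𝓟 S j := by
  have : ∑ i ∈ Finset.Ico 1 j, slope 𝓟' S' i + ∑ i ∈ Finset.Ico 1 j, b i ≤
      ∑ i ∈ Finset.Ico 1 j, slope 𝓟 S i := by
    rw [← Finset.sum_add_distrib]
    exact Finset.sum_le_sum fun i hi => hs i (Finset.mem_Ico.1 hi).1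
  unfold demand
  linarith

/-- The fall of `demand` at j when its first c increments fall by one. -/
theorem sum_Ico_le_indicator (c j : ℕ) :
    ∑ i ∈ Finset.Ico 1 j, (if i ≤ c then (1 : ℤ) else 0) = ((min (j - 1) c : ℕ) : ℤ) := by
  rw [Finset.sum_boole]
  congr 1
  have : (Finset.Ico 1 j).filter (fun i => i ≤ c) = Finset.Ico 1 (min (j - 1) c + 1) := by
    ext i
    simp only [Finset.mem_filter, Finset.mem_Ico]
    omega
  rw [this, Nat.card_Ico]
  omega

/-- The fall of `demand` at j when every increment except the u-th falls by one. -/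
theorem sum_Ico_ne_indicator (u j : ℕ) (hj : 1 ≤ j) :
    (j : ℤ) - 1 - (if u < j then 1 else 0) ≤
      ∑ i ∈ Finset.Ico 1 j, (if i = u then (0 : ℤ) else 1) := by
  have h : ∀ i ∈ Finset.Ico 1 j, (if i = u then (0 : ℤ) else 1) = 1 - if i = u then 1 else 0 := by
    intro i _
    split_ifs <;> rfl
  rw [Finset.sum_congr rfl h, Finset.sum_sub_distrib, Finset.sum_ite_eq']
  simp only [Finset.sum_const, Nat.card_Ico, Finset.mem_Ico, nsmul_eq_mul, mul_one]
  split_ifs <;> omega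

variable {G : SimpleGraph V} {𝓟 : Finset (Finset V)} {S : Finset (V × ℕ × ℕ)}
  {X : Finset V} {g : V → ℤ}

theorem Safe.pos (h : Safe G 𝓟 S X g) {v : V} (hv : v ∈ X) : 0 < g v := by
  rcases h.cover v hv with ⟨P, hP, hvP⟩ | ⟨s, hs, rfl⟩
  · have h1 := h.part P hP {v} (by simpa using hvP) (by simp)
    simp only [Finset.card_singleton, demand_one, Finset.sum_singleton] at h1
    have : (0 : ℤ) < 𝓟.card := by exact_mod_cast Finset.card_pos.2 ⟨P, hP⟩
    linarith
  · have := h.single s hs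
    have := width_nonneg 𝓟 s.2.1
    have := countBefore_pos hs
    linarith

variable [DecidableEq V]

theorem width_erase {𝓟 : Finset (Finset V)} {P : Finset V} (hP : P ∈ 𝓟) (i : ℕ) :
    width (𝓟.erase P) i + max ((P.card : ℤ) - i) 1 = width 𝓟 i :=
  Finset.sum_erase_add 𝓟 _ hP

theorem width_insert_le (𝓟 : Finset (Finset V)) (P : Finset V) (i : ℕ) :
    width (insert P 𝓟) i ≤ width 𝓟 i + max ((P.card : ℤ) - i) 1 := by
  by_cases h : P ∈ 𝓟
  · rw [Finset.insert_eq_of_mem h]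
    have : (1 : ℤ) ≤ max ((P.card : ℤ) - i) 1 := le_max_right _ _
    linarith
  · unfold width
    rw [Finset.sum_insert h, add_comm]

theorem card_erase_int {𝓟 : Finset (Finset V)} {P : Finset V} (hP : P ∈ 𝓟) :
    ((𝓟.erase P).card : ℤ) + 1 = 𝓟.card := by
  exact_mod_cast Finset.card_erase_add_one hP

/-- Bob colours a part all of whose vertices are marked. -/
theorem Safe.take_part (h : Safe G 𝓟 S X g) {P : Finset V} (hP : P ∈ 𝓟) (U : Finset V) :
    Safe G (𝓟.erase P) S (X \ P) (spend g U) where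
  cover v hv := by
    rw [Finset.mem_sdiff] at hv
    rcases h.cover v hv.1 with ⟨Q, hQ, hvQ⟩ | hs
    · exact Or.inl ⟨Q, Finset.mem_erase.2 ⟨fun e => hv.2 (e ▸ hvQ), hQ⟩, hvQ⟩
    · exact Or.inr hs
  indep Q hQ := h.indep Q (Finset.mem_of_mem_erase hQ)
  part Q hQ T hT hne := by
    have h1 := h.part Q (Finset.mem_of_mem_erase hQ) T hT hne
    -- The initial value and all increments fall by one, so `demand` at |T| falls by |T|, the most
    -- that T can spend.
    have h2 := demand_add_le (S := S) (S' := S) (a := 1) (b := fun _ => 1) (card_erase_int hP).le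
      (fun i _ => by
        have := width_erase hP i
        have : (1 : ℤ) ≤ max ((P.card : ℤ) - i) 1 := le_max_right _ _
        unfold slope
        linarith) T.card
    have h3 : (T ∩ U).card ≤ T.card := Finset.card_le_card Finset.inter_subset_left
    have h4 : 0 < T.card := hne.card_pos
    simp only [Finset.sum_const, Nat.card_Ico, nsmul_eq_mul, mul_one] at h2
    rw [sum_spend]
    omega
  single s hs := by
    have h1 := h.single s hs
    have := width_erase hP s.2.1
    have : (1 : ℤ) ≤ max ((P.card : ℤ) - s.2.1) 1 := le_max_right _ _
    have := le_spend g U s.1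
    linarith

end Position

/-! ### Bob's replies preserve the invariant. -/

section Replies

variable {V : Type*} [DecidableEq V] {G : SimpleGraph V} {𝓟 : Finset (Finset V)}
  {S : Finset (V × ℕ × ℕ)} {X U : Finset V} {g : V → ℤ}

theorem countAbove_union_le (S I : Finset (V × ℕ × ℕ)) (i : ℕ) :
    countAbove (S ∪ I) i ≤ countAbove S i + countAbove I i := by
  unfold countAbove
  rw [Finset.filter_union]
  exact_mod_cast Finset.card_union_le _ _

theorem countBefore_union_le (S I : Finset (V × ℕ × ℕ)) (s : V × ℕ × ℕ) :
    countBefore (S ∪ I) s ≤ countBefore S s + countBefore I s := by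
  unfold countBefore
  rw [Finset.filter_union]
  exact_mod_cast Finset.card_union_le _ _

theorem countAbove_image_le (R : Finset V) (c r i : ℕ) :
    countAbove (R.image fun v => (v, c, r)) i ≤ if i ≤ c then (R.card : ℤ) else 0 := by
  unfold countAbove
  split_ifs with h
  · exact_mod_cast (Finset.card_filter_le _ _).trans Finset.card_image_le
  · rw [Finset.filter_false_of_mem, Finset.card_empty, Nat.cast_zero]
    intro s hs
    obtain ⟨v, -, rfl⟩ := Finset.mem_image.1 hs
    exact h

/-- New vertices of rank above that of s stand behind s within its class, so only a higher class
puts them ahead. -/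
theorem countBefore_image_le (R : Finset V) (c r : ℕ) (s : V × ℕ × ℕ) (hs : s.2.2 < r) :
    countBefore (R.image fun v => (v, c, r)) s ≤ if s.2.1 < c then (R.card : ℤ) else 0 := by
  unfold countBefore
  split_ifs with h
  · exact_mod_cast (Finset.card_filter_le _ _).trans Finset.card_image_le
  · rw [Finset.filter_false_of_mem, Finset.card_empty, Nat.cast_zero]
    intro s' hs'
    obtain ⟨v, -, rfl⟩ := Finset.mem_image.1 hs'
    simp only
    omega

theorem countAbove_erase {s : V × ℕ × ℕ} (hs : s ∈ S) (i : ℕ) :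
    countAbove (S.erase s) i + (if i ≤ s.2.1 then 1 else 0) = countAbove S i := by
  unfold countAbove
  rw [Finset.filter_erase]
  split_ifs with h
  · exact_mod_cast Finset.card_erase_add_one (Finset.mem_filter.2 ⟨hs, h⟩)
  · rw [Finset.erase_eq_of_notMem (by simp [h]), add_zero]

theorem countBefore_erase {s : V × ℕ × ℕ} (hs : s ∈ S) (s' : V × ℕ × ℕ) :
    countBefore (S.erase s) s' +
      (if s'.2.1 < s.2.1 ∨ s.2.1 = s'.2.1 ∧ s.2.2 ≤ s'.2.2 then 1 else 0) = countBefore S s' := by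
  unfold countBefore
  rw [Finset.filter_erase]
  split_ifs with h
  · exact_mod_cast Finset.card_erase_add_one (Finset.mem_filter.2 ⟨hs, h⟩)
  · rw [Finset.erase_eq_of_notMem (by simp [h]), add_zero]

theorem card_eq_inter_add_sdiff (P U : Finset V) :
    (P.card : ℤ) = (P ∩ U).card + (P \ U).card := by
  exact_mod_cast (Finset.card_inter_add_card_sdiff P U).symm

/-- Bob colours the marked vertices of a part which contains a largest tight marked set. -/
theorem Safe.take_tight (h : Safe G 𝓟 S X g) {P T₀ : Finset V} (hP : P ∈ 𝓟) (hPU : ¬ P ⊆ U)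
    (hT₀ : T₀ ⊆ P) (hT₀U : T₀ ⊆ U) (hne₀ : T₀.Nonempty)
    (htight : ∑ v ∈ T₀, g v = demand 𝓟 S T₀.card)
    (hmax : ∀ Q ∈ 𝓟, ∀ T ⊆ Q, T ⊆ U → T₀.card < T.card → demand 𝓟 S T.card < ∑ v ∈ T, g v) :
    ∃ S', Safe G (𝓟.erase P) S' (X \ (P ∩ U)) (spend g U) := by
  set u := (P ∩ U).card with hu
  have hr : 0 < (P \ U).card := Finset.card_pos.2 (Finset.sdiff_nonempty.2 hPU)
  have hp := card_eq_inter_add_sdiff P U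
  rw [← hu] at hp
  have htu : T₀.card ≤ u := Finset.card_le_card (Finset.subset_inter hT₀ hT₀U)
  -- The new single vertices go last within their class u.
  obtain ⟨ρ, hρ⟩ : ∃ ρ, ∀ s ∈ S, s.2.2 < ρ :=
    ⟨S.sup (fun s => s.2.2) + 1, fun s hs =>
      Nat.lt_succ_of_le (Finset.le_sup (f := fun s : V × ℕ × ℕ => s.2.2) hs)⟩
  -- With r = |P \ U|, `width` loses max(u + r - i, 1) and r single vertices are gained for i ≤ u;
  -- the net loss can vanish only at i = u.
  have hslope : ∀ i, 1 ≤ i → slope (𝓟.erase P) (S ∪ (P \ U).image fun v => (v, u, ρ)) i +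
      (if i = u then (0 : ℤ) else 1) ≤ slope 𝓟 S i := by
    intro i _
    have h1 := countAbove_union_le S ((P \ U).image fun v => (v, u, ρ)) i
    have h2 := countAbove_image_le (P \ U) u ρ i
    have h3 := width_erase hP i
    unfold slope
    split_ifs at h2 ⊢ <;> omega
  have hdem := demand_add_le (card_erase_int hP).le hslope
  refine ⟨S ∪ (P \ U).image (fun v => (v, u, ρ)), ?_, ?_, ?_, ?_⟩
  · intro v hv
    simp only [Finset.mem_sdiff, Finset.mem_inter, not_and] at hv
    rcases h.cover v hv.1 with ⟨Q, hQ, hvQ⟩ | ⟨s, hs, hsv⟩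
    · by_cases hQP : Q = P
      · subst hQP
        exact Or.inr ⟨(v, u, ρ), Finset.mem_union_right _
          (Finset.mem_image_of_mem _ (Finset.mem_sdiff.2 ⟨hvQ, hv.2 hvQ⟩)), rfl⟩
      · exact Or.inl ⟨Q, Finset.mem_erase.2 ⟨hQP, hQ⟩, hvQ⟩
    · exact Or.inr ⟨s, Finset.mem_union_left _ hs, hsv⟩
  · exact fun Q hQ => h.indep Q (Finset.mem_of_mem_erase hQ)
  · intro Q hQ T hT hne
    have hQ' := Finset.mem_of_mem_erase hQ
    have h1 := h.part Q hQ' T hT hne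
    have h2 := hdem T.card
    have h3 := sum_Ico_ne_indicator u T.card hne.card_pos
    have h4 : (T ∩ U).card ≤ T.card := Finset.card_le_card Finset.inter_subset_left
    rw [sum_spend]
    -- Only sets larger than u miss one unit: a fully marked one exceeds `T₀` in size, so is not
    -- tight, and any other keeps a token.
    by_cases hTu : u < T.card
    · rw [if_pos hTu] at h3
      by_cases hTU : T ⊆ U
      · have := hmax Q hQ' T hT hTU (by omega)
        omega
      · have : (T ∩ U).card < T.card := by
          refine Finset.card_lt_card ⟨Finset.inter_subset_left, fun hs => hTU ?_⟩
          exact hs.trans Finset.inter_subset_right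
        omega
    · rw [if_neg hTu] at h3
      omega
  · intro s hs
    rcases Finset.mem_union.1 hs with hs | hs
    · have h1 := h.single s hs
      have h2 := countBefore_union_le S ((P \ U).image fun v => (v, u, ρ)) s
      have h3 := countBefore_image_le (P \ U) u ρ s (hρ s hs)
      -- Below class u, `width` falls by at least r + 1: r for the new vertices ahead, one for the
      -- token.
      have h4 := width_erase hP s.2.1
      have h5 := le_spend g U s.1
      split_ifs at h3 <;> omega
    · obtain ⟨w, hw, rfl⟩ := Finset.mem_image.1 hs
      rw [Finset.mem_sdiff] at hw
      have h1 := countBefore_le_countAbove (S ∪ (P \ U).image fun v => (v, u, ρ)) (w, u, ρ)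
      have h2 := hslope u (hne₀.card_pos.trans_le htu)
      have h3 := slope_antitone 𝓟 S htu
      -- Since `T₀` is tight, w has at least `slope` at |T₀|, hence at least `slope` at u, which did
      -- not increase.
      have hwT : w ∉ T₀ := fun hwT => hw.2 (hT₀U hwT)
      have h4 := h.part P hP (insert w T₀) (Finset.insert_subset hw.1 hT₀)
        (Finset.insert_nonempty _ _)
      rw [Finset.card_insert_of_notMem hwT, Finset.sum_insert hwT,
        demand_succ _ _ hne₀.card_pos, htight] at h4
      rw [if_pos rfl] at h2
      rw [spend_of_notMem hw.2]
      unfold slope at h2 h3 h4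
      dsimp only at h1 ⊢
      linarith

/-- Bob colours the first marked single vertex. -/
theorem Safe.take_single (h : Safe G 𝓟 S X g) {s₀ : V × ℕ × ℕ} (hs₀ : s₀ ∈ S)
    (hfirst : ∀ s ∈ S, s.1 ∈ U → s.2.1 < s₀.2.1 ∨ s₀.2.1 = s.2.1 ∧ s₀.2.2 ≤ s.2.2)
    (hslack : ∀ Q ∈ 𝓟, ∀ T ⊆ Q, T ⊆ U → T.Nonempty → demand 𝓟 S T.card < ∑ v ∈ T, g v)
    (hu : ∀ Q ∈ 𝓟, (Q ∩ U).card ≤ s₀.2.1) :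
    Safe G 𝓟 (S.erase s₀) (X \ {s₀.1}) (spend g U) where
  cover v hv := by
    rw [Finset.mem_sdiff, Finset.mem_singleton] at hv
    rcases h.cover v hv.1 with hP | ⟨s, hs, hsv⟩
    · exact Or.inl hP
    · exact Or.inr ⟨s, Finset.mem_erase.2 ⟨fun e => hv.2 (by rw [← hsv, e]), hs⟩, hsv⟩
  indep := h.indep
  part Q hQ T hT hne := by
    have h1 := h.part Q hQ T hT hne
    have h2 := demand_add_le (𝓟' := 𝓟) (S' := S.erase s₀) (S := S) (a := 0)
      (b := fun i => if i ≤ s₀.2.1 then 1 else 0) (add_zero _).le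
      (fun i _ => by
        have := countAbove_erase hs₀ i
        unfold slope
        linarith) T.card
    rw [sum_Ico_le_indicator] at h2
    have h3 := hne.card_pos
    have h4 : (T ∩ U).card ≤ (Q ∩ U).card :=
      Finset.card_le_card (Finset.inter_subset_inter_right hT)
    have h5 := hu Q hQ
    have h6 : (T ∩ U).card ≤ T.card := Finset.card_le_card Finset.inter_subset_left
    rw [sum_spend]
    -- `demand` falls by the minimum of |T| - 1 and the class of `s₀`; only a fully marked T can
    -- spend more, by one, and `hslack` covers it.
    by_cases hTU : T ⊆ U
    · have := hslack Q hQ T hT hTU hne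
      omega
    · have : (T ∩ U).card < T.card := by
        refine Finset.card_lt_card ⟨Finset.inter_subset_left, fun hs => hTU ?_⟩
        exact hs.trans Finset.inter_subset_right
      omega
  single s hs := by
    have hs' := Finset.mem_of_mem_erase hs
    have h1 := h.single s hs'
    have h2 := countBefore_erase hs₀ s
    by_cases hsU : s.1 ∈ U
    · rw [if_pos (hfirst s hs' hsU)] at h2
      have := le_spend g U s.1
      linarith
    · rw [spend_of_notMem hsU]
      split_ifs at h2 <;> linarith

/-- Bob colours the marked vertices of a part with most marked vertices, and keeps the rest of
this part. -/
theorem Safe.take_most (h : Safe G 𝓟 S X g) {P : Finset V} (hP : P ∈ 𝓟)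
    (hu : ∀ Q ∈ 𝓟, (Q ∩ U).card ≤ (P ∩ U).card)
    (hS : ∀ s ∈ S, s.1 ∈ U → s.2.1 < (P ∩ U).card)
    (hslack : ∀ Q ∈ 𝓟, ∀ T ⊆ Q, T ⊆ U → T.Nonempty → demand 𝓟 S T.card < ∑ v ∈ T, g v)
    (hr : 2 ≤ (P \ U).card) :
    Safe G (insert (P \ U) (𝓟.erase P)) S (X \ (P ∩ U)) (spend g U) := by
  have hp := card_eq_inter_add_sdiff P U
  have hsub : ∀ Q ∈ insert (P \ U) (𝓟.erase P), ∃ Q' ∈ 𝓟, Q ⊆ Q' := by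
    intro Q hQ
    rcases Finset.mem_insert.1 hQ with rfl | hQ
    · exact ⟨P, hP, Finset.sdiff_subset⟩
    · exact ⟨Q, Finset.mem_of_mem_erase hQ, Finset.Subset.refl _⟩
  refine ⟨?_, ?_, ?_, ?_⟩
  · intro v hv
    simp only [Finset.mem_sdiff, Finset.mem_inter, not_and] at hv
    rcases h.cover v hv.1 with ⟨Q, hQ, hvQ⟩ | hs
    · by_cases hQP : Q = P
      · subst hQP
        exact Or.inl ⟨_, Finset.mem_insert_self _ _, Finset.mem_sdiff.2 ⟨hvQ, hv.2 hvQ⟩⟩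
      · exact Or.inl ⟨Q, Finset.mem_insert_of_mem (Finset.mem_erase.2 ⟨hQP, hQ⟩), hvQ⟩
    · exact Or.inr hs
  · intro Q hQ
    obtain ⟨Q', hQ', hQQ'⟩ := hsub Q hQ
    exact (h.indep Q' hQ').mono (Finset.coe_subset.2 hQQ')
  · intro Q₁ hQ₁ T hT₁ hne
    obtain ⟨Q, hQ, hQQ⟩ := hsub Q₁ hQ₁
    have hT := hT₁.trans hQQ
    have h1 := h.part Q hQ T hT hne
    -- As |P \ U| ≥ 2, the first increment falls by |P ∩ U|, enough for all sets of size at least 2;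
    -- a marked singleton uses its slack.
    have h2 := demand_add_le (𝓟' := insert (P \ U) (𝓟.erase P)) (𝓟 := 𝓟) (S' := S) (S := S)
      (a := 0) (b := fun i => if i = 1 then ((P ∩ U).card : ℤ) else 0)
      (by
        have := card_erase_int hP
        have := Finset.card_insert_le (P \ U) (𝓟.erase P)
        omega)
      (fun i hi => by
        have h1 := width_insert_le (𝓟.erase P) (P \ U) i
        have h2 := width_erase hP i
        unfold slope
        split_ifs <;> omega) T.card
    rw [Finset.sum_ite_eq'] at h2
    have h3 := hne.card_pos
    have h4 : (T ∩ U).card ≤ (Q ∩ U).card :=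
      Finset.card_le_card (Finset.inter_subset_inter_right hT)
    have h5 := hu Q hQ
    have h6 : (T ∩ U).card ≤ T.card := Finset.card_le_card Finset.inter_subset_left
    rw [sum_spend]
    simp only [Finset.mem_Ico, le_refl, true_and] at h2
    by_cases hTU : T ⊆ U
    · have := hslack Q hQ T hT hTU hne
      split_ifs at h2 <;> omega
    · have : (T ∩ U).card < T.card := by
        refine Finset.card_lt_card ⟨Finset.inter_subset_left, fun hs => hTU ?_⟩
        exact hs.trans Finset.inter_subset_right
      split_ifs at h2 <;> omega
  · intro s hs
    have h1 := h.single s hs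
    have h2 := width_insert_le (𝓟.erase P) (P \ U) s.2.1
    have h3 := width_erase hP s.2.1
    by_cases hsU : s.1 ∈ U
    · have := hS s hs hsU
      have := le_spend g U s.1
      omega
    · rw [spend_of_notMem hsU]
      omega

/-- Bob colours all but one vertex of a part with most marked vertices; the remaining vertex
becomes the first single vertex. -/
theorem Safe.take_most_of_card_sdiff_eq_one (h : Safe G 𝓟 S X g) {P : Finset V} (hP : P ∈ 𝓟)
    (hu : ∀ Q ∈ 𝓟, (Q ∩ U).card ≤ (P ∩ U).card)
    (hS : ∀ s ∈ S, s.1 ∈ U → s.2.1 < (P ∩ U).card)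
    (hpos : 0 < (P ∩ U).card) (hr : (P \ U).card = 1) :
    ∃ S', Safe G (𝓟.erase P) S' (X \ (P ∩ U)) (spend g U) := by
  have hp := card_eq_inter_add_sdiff P U
  obtain ⟨z, hz⟩ := Finset.card_eq_one.1 hr
  have hzP : z ∈ P ∧ z ∉ U := by
    rw [← Finset.mem_sdiff, hz]
    exact Finset.mem_singleton_self z
  -- The class c puts z ahead of all single vertices and makes each part count once in `width`, so z
  -- needs only |𝓟| tokens, which `demand` at 1 guarantees.
  obtain ⟨c, hc, hcP⟩ : ∃ c, (∀ s ∈ S, s.2.1 < c) ∧ ∀ Q ∈ 𝓟, Q.card ≤ c + 1 := by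
    refine ⟨S.sup (fun s => s.2.1) + 1 + 𝓟.sup Finset.card, fun s hs => ?_, fun Q hQ => ?_⟩
    · have := Finset.le_sup (f := fun s : V × ℕ × ℕ => s.2.1) hs
      omega
    · have := Finset.le_sup (f := Finset.card) hQ
      omega
  have hcount : ∀ p : V × ℕ × ℕ → Prop, ∀ [DecidablePred p],
      (((insert (z, c, 0) S).filter p).card : ℤ) ≤ (S.filter p).card + 1 := by
    intro p _
    rw [Finset.filter_insert]
    split_ifs
    · exact_mod_cast Finset.card_insert_le _ _
    · omega
  refine ⟨insert (z, c, 0) S, ?_, ?_, ?_, ?_⟩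
  · intro v hv
    simp only [Finset.mem_sdiff, Finset.mem_inter, not_and] at hv
    rcases h.cover v hv.1 with ⟨Q, hQ, hvQ⟩ | ⟨s, hs, hsv⟩
    · by_cases hQP : Q = P
      · subst hQP
        have : v ∈ Q \ U := Finset.mem_sdiff.2 ⟨hvQ, hv.2 hvQ⟩
        rw [hz, Finset.mem_singleton] at this
        exact Or.inr ⟨(z, c, 0), Finset.mem_insert_self _ _, this.symm⟩
      · exact Or.inl ⟨Q, Finset.mem_erase.2 ⟨hQP, hQ⟩, hvQ⟩
    · exact Or.inr ⟨s, Finset.mem_insert_of_mem hs, hsv⟩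
  · exact fun Q hQ => h.indep Q (Finset.mem_of_mem_erase hQ)
  · intro Q hQ' T hT hne
    have hQ := Finset.mem_of_mem_erase hQ'
    have h1 := h.part Q hQ T hT hne
    -- Losing a part gives 1, and the increments up to |P ∩ U| - 1 give 1 each: in total min(|T|, |P
    -- ∩ U|), so no slack is needed.
    have h2 := demand_add_le (S' := insert (z, c, 0) S) (S := S)
      (b := fun i => if i ≤ (P ∩ U).card - 1 then (1 : ℤ) else 0)
      (card_erase_int hP).le
      (fun i hi => by
        have h1 := width_erase hP i
        have h2 : countAbove (insert (z, c, 0) S) i ≤ countAbove S i + 1 := hcount _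
        unfold slope
        split_ifs <;> omega) T.card
    rw [sum_Ico_le_indicator] at h2
    have h3 := hne.card_pos
    have h4 : (T ∩ U).card ≤ (Q ∩ U).card :=
      Finset.card_le_card (Finset.inter_subset_inter_right hT)
    have h5 := hu Q hQ
    have h6 : (T ∩ U).card ≤ T.card := Finset.card_le_card Finset.inter_subset_left
    rw [sum_spend]
    omega
  · intro s hs
    rcases Finset.mem_insert.1 hs with rfl | hs
    · have h1 : countBefore (insert (z, c, 0) S) (z, c, 0) ≤ 1 := by
        have : S.filter (fun s' => c < s'.2.1 ∨ s'.2.1 = c ∧ s'.2.2 ≤ 0) = ∅ :=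
          Finset.filter_false_of_mem fun s' hs' => by
            have := hc s' hs'
            omega
        have h' := hcount (fun s' => c < s'.2.1 ∨ s'.2.1 = c ∧ s'.2.2 ≤ 0)
        rw [this, Finset.card_empty] at h'
        simpa [countBefore] using h'
      have h2 := width_eq_card (𝓟 := 𝓟.erase P) (i := c)
        fun Q hQ => hcP Q (Finset.mem_of_mem_erase hQ)
      have h3 := h.part P hP {z} (by simpa using hzP.1) (by simp)
      have h4 := card_erase_int hP
      rw [Finset.card_singleton, demand_one, Finset.sum_singleton] at h3
      rw [spend_of_notMem hzP.2]
      linarith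
    · have h1 := h.single s hs
      have h2 : countBefore (insert (z, c, 0) S) s ≤ countBefore S s + 1 := hcount _
      have h3 := width_erase hP s.2.1
      -- For a marked s the class is below |P ∩ U|, so `width` falls by 2: one for z ahead of it,
      -- one for the token.
      by_cases hsU : s.1 ∈ U
      · have := hS s hs hsU
        have := le_spend g U s.1
        omega
      · rw [spend_of_notMem hsU]
        omega

/-- Bob has a reply to each marked set. -/
theorem Safe.exists_reply (h : Safe G 𝓟 S X g) (U : Finset V) :
    ∃ Y : Finset V, Y ⊆ U ∧ G.IsIndepSet (Y : Set V) ∧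
      ∃ 𝓟' S', Safe G 𝓟' S' (X \ Y) (spend g U) := by
  classical
  by_cases hfull : ∃ P ∈ 𝓟, P ⊆ U
  · obtain ⟨P, hP, hPU⟩ := hfull
    exact ⟨P, hPU, h.indep P hP, _, _, h.take_part hP U⟩
  push Not at hfull
  have hinter : ∀ P ∈ 𝓟, G.IsIndepSet ((P ∩ U : Finset V) : Set V) := fun P hP =>
    (h.indep P hP).mono (Finset.coe_subset.2 Finset.inter_subset_left)
  by_cases ht : ∃ T ∈ U.powerset, T.Nonempty ∧ ∑ v ∈ T, g v = demand 𝓟 S T.card ∧ ∃ P ∈ 𝓟, T ⊆ P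
  · obtain ⟨T, hT, hmax⟩ := Finset.exists_max_image
      (U.powerset.filter fun T =>
        T.Nonempty ∧ ∑ v ∈ T, g v = demand 𝓟 S T.card ∧ ∃ P ∈ 𝓟, T ⊆ P)
      Finset.card (by obtain ⟨T, hT⟩ := ht; exact ⟨T, Finset.mem_filter.2 hT⟩)
    simp only [Finset.mem_filter, Finset.mem_powerset] at hT hmax
    obtain ⟨hTU, hne, heq, P, hP, hTP⟩ := hT
    obtain ⟨S', hS'⟩ := h.take_tight hP (hfull P hP) hTP hTU hne heq
      (fun Q hQ T' hT' hTU' hlt => by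
        have hne' : T'.Nonempty := Finset.card_pos.1 ((Nat.zero_le _).trans_lt hlt)
        refine lt_of_le_of_ne (h.part Q hQ T' hT' hne') fun he => ?_
        exact absurd (hmax T' ⟨hTU', hne', he.symm, Q, hQ, hT'⟩) (not_le.2 hlt))
    exact ⟨P ∩ U, Finset.inter_subset_right, hinter P hP, _, S', hS'⟩
  have hslack : ∀ Q ∈ 𝓟, ∀ T ⊆ Q, T ⊆ U → T.Nonempty → demand 𝓟 S T.card < ∑ v ∈ T, g v := by
    intro Q hQ T hT hTU hne
    refine lt_of_le_of_ne (h.part Q hQ T hT hne) fun he => ht ?_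
    exact ⟨T, Finset.mem_powerset.2 hTU, hne, he.symm, Q, hQ, hT⟩
  by_cases hs : ∃ s ∈ S, s.1 ∈ U ∧ ∀ Q ∈ 𝓟, (Q ∩ U).card ≤ s.2.1
  · obtain ⟨s₁, hs₁, hs₁U, hs₁c⟩ := hs
    -- The lexicographic order with dual rank selects the highest class, then the lowest rank.
    obtain ⟨s₀, hs₀, hfirst⟩ := Finset.exists_max_image (S.filter fun s => s.1 ∈ U)
      (fun s => toLex (s.2.1, OrderDual.toDual s.2.2)) ⟨s₁, Finset.mem_filter.2 ⟨hs₁, hs₁U⟩⟩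
    rw [Finset.mem_filter] at hs₀
    have hfirst' : ∀ s ∈ S, s.1 ∈ U →
        s.2.1 < s₀.2.1 ∨ s₀.2.1 = s.2.1 ∧ s₀.2.2 ≤ s.2.2 := by
      intro s hs hsU
      have := hfirst s (Finset.mem_filter.2 ⟨hs, hsU⟩)
      rw [Prod.Lex.toLex_le_toLex] at this
      simpa [eq_comm] using this
    refine ⟨{s₀.1}, by simpa using hs₀.2, by simp, _, _,
      h.take_single hs₀.1 hfirst' hslack fun Q hQ => (hs₁c Q hQ).trans ?_⟩
    have := hfirst' s₁ hs₁ hs₁U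
    omega
  push Not at hs
  -- If no part is marked, neither is any single vertex, since its class would be negative; Bob may
  -- pass.
  by_cases hempty : ∀ Q ∈ 𝓟, (Q ∩ U).card = 0
  · refine ⟨∅, Finset.empty_subset _, by simp, 𝓟, S, ?_⟩
    have hSU : ∀ s ∈ S, s.1 ∉ U := fun s hsS hsU => by
      obtain ⟨Q, hQ, hlt⟩ := hs s hsS hsU
      rw [hempty Q hQ] at hlt
      omega
    refine ⟨by simpa using h.cover, h.indep, fun Q hQ T hT hne => ?_, fun s hsS => ?_⟩
    · have h4 : (T ∩ U).card ≤ (Q ∩ U).card :=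
        Finset.card_le_card (Finset.inter_subset_inter_right hT)
      rw [hempty Q hQ] at h4
      have := h.part Q hQ T hT hne
      rw [sum_spend]
      omega
    · rw [spend_of_notMem (hSU s hsS)]
      exact h.single s hsS
  push Not at hempty
  obtain ⟨Q₀, hQ₀, hQ₀U⟩ := hempty
  obtain ⟨P, hP, hu⟩ := Finset.exists_max_image 𝓟 (fun Q => (Q ∩ U).card) ⟨Q₀, hQ₀⟩
  have hS : ∀ s ∈ S, s.1 ∈ U → s.2.1 < (P ∩ U).card := fun s hsS hsU => by
    obtain ⟨Q, hQ, hlt⟩ := hs s hsS hsU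
    exact hlt.trans_le (hu Q hQ)
  have hpos : 0 < (P ∩ U).card := (Nat.pos_of_ne_zero hQ₀U).trans_le (hu Q₀ hQ₀)
  have hr : 0 < (P \ U).card := Finset.card_pos.2 (Finset.sdiff_nonempty.2 (hfull P hP))
  refine ⟨P ∩ U, Finset.inter_subset_right, hinter P hP, ?_⟩
  rcases Nat.lt_or_ge 1 (P \ U).card with hr2 | hr1
  · exact ⟨_, _, h.take_most hP hu hS hslack hr2⟩
  · exact ⟨_, h.take_most_of_card_sdiff_eq_one hP hu hS hpos (le_antisymm hr1 hr)⟩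

theorem onlineChoosable_of_safe [Fintype V] {f : V → ℕ}
    (h : Safe G 𝓟 S Finset.univ (fun v => f v)) : OnlineChoosable G f :=
  onlineChoosable_of_invariant (fun X g => ∃ 𝓟 S, Safe G 𝓟 S X g) ⟨𝓟, S, h⟩
    (fun _ _ ⟨_, _, h⟩ _ hv => h.pos hv) (fun _ _ U ⟨_, _, h⟩ => h.exists_reply U)

end Replies

/-! ### Parts of a complete multipartite graph and the initial position. -/

section Multipartite

open scoped Classical in
/-- The parts of a complete multipartite graph. -/
noncomputable def parts {V : Type*} [Fintype V] {G : SimpleGraph V}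
    (hG : G.IsCompleteMultipartite) : Finset (Finset V) :=
  Finset.univ.filter fun P => (P : Set V) ∈ hG.setoid.classes

variable {V : Type*} [Fintype V] {G : SimpleGraph V} (hG : G.IsCompleteMultipartite)

theorem mem_parts {P : Finset V} : P ∈ parts hG ↔ ∃ y, ∀ x, x ∈ P ↔ ¬ G.Adj x y := by
  classical
  unfold parts
  rw [Finset.mem_filter, and_iff_right (Finset.mem_univ P)]
  exact exists_congr fun y => Set.ext_iff

theorem not_adj_of_mem_parts {P : Finset V} (hP : P ∈ parts hG) {x y : V} (hx : x ∈ P)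
    (hy : y ∈ P) : ¬ G.Adj x y := by
  obtain ⟨z, hz⟩ := (mem_parts hG).1 hP
  exact hG.setoid.trans' ((hz x).1 hx) (hG.setoid.symm' ((hz y).1 hy))

theorem isIndepSet_of_mem_parts {P : Finset V} (hP : P ∈ parts hG) :
    G.IsIndepSet (P : Set V) :=
  fun _ hx _ hy _ => not_adj_of_mem_parts hG hP hx hy

theorem nonempty_of_mem_parts {P : Finset V} (hP : P ∈ parts hG) : P.Nonempty := by
  obtain ⟨z, hz⟩ := (mem_parts hG).1 hP
  exact ⟨z, (hz z).2 G.irrefl⟩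

theorem exists_mem_parts (v : V) : ∃ P ∈ parts hG, v ∈ P := by
  classical
  exact ⟨Finset.univ.filter fun x => ¬ G.Adj x v, (mem_parts hG).2 ⟨v, by simp⟩, by simp⟩

theorem eq_of_not_adj {P Q : Finset V} (hP : P ∈ parts hG) (hQ : Q ∈ parts hG) {x y : V}
    (hx : x ∈ P) (hy : y ∈ Q) (hxy : ¬ G.Adj x y) : P = Q := by
  obtain ⟨p, hp⟩ := (mem_parts hG).1 hP
  obtain ⟨q, hq⟩ := (mem_parts hG).1 hQ
  have hpq : ¬ G.Adj p q := hG.setoid.trans' (hG.setoid.symm' ((hp x).1 hx))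
    (hG.setoid.trans' hxy ((hq y).1 hy))
  ext v
  rw [hp, hq]
  exact ⟨fun h => hG.setoid.trans' h hpq, fun h => hG.setoid.trans' h (hG.setoid.symm' hpq)⟩

theorem numParts_eq (p : ℕ) :
    numParts hG p = ((parts hG).filter fun P => P.card = p).card := by
  classical
  unfold numParts
  rw [← Set.ncard_coe_finset, ← Set.ncard_image_of_injective _ Finset.coe_injective]
  congr 1
  ext X
  simp only [Set.mem_ofPred_eq, Set.mem_image, Finset.mem_coe, Finset.mem_filter, parts,
    Finset.mem_univ, true_and]
  constructor
  · rintro ⟨hX, hc⟩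
    refine ⟨X.toFinset, ⟨by simpa using hX, ?_⟩, by simp⟩
    rw [← hc, Set.ncard_eq_toFinset_card']
  · rintro ⟨P, ⟨hP, hc⟩, rfl⟩
    exact ⟨hP, by rw [Set.ncard_coe_finset, hc]⟩

theorem card_parts_le_of_colorable {n : ℕ} (h : G.Colorable n) : (parts hG).card ≤ n := by
  classical
  obtain ⟨C⟩ := h
  choose r hr using fun P : parts hG => nonempty_of_mem_parts hG P.2
  have := Fintype.card_le_of_injective (fun P => C (r P)) fun P Q he =>
    Subtype.ext (eq_of_not_adj hG P.2 Q.2 (hr P) (hr Q) fun hadj => C.valid hadj he)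
  simpa using this

theorem card_parts_filter_add_numParts_one :
    ((parts hG).filter fun P => 2 ≤ P.card).card + numParts hG 1 = (parts hG).card := by
  rw [numParts_eq, ← Finset.card_filter_add_card_filter_not (s := parts hG) fun P => 2 ≤ P.card]
  congr 2
  refine Finset.filter_congr fun P hP => ?_
  have := (nonempty_of_mem_parts hG hP).card_pos
  omega

theorem sum_parts_filter {m : ℕ} (hm : ∀ P ∈ parts hG, P.card ≤ m) (φ : ℕ → ℝ) :
    ∑ P ∈ (parts hG).filter (fun P => 2 ≤ P.card), φ P.card =
      ∑ p ∈ Finset.Icc 2 m, φ p * numParts hG p := by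
  rw [← Finset.sum_fiberwise_of_maps_to (t := Finset.Icc 2 m) (g := Finset.card)
    (fun P hP => by
      rw [Finset.mem_filter] at hP
      exact Finset.mem_Icc.2 ⟨hP.2, hm P hP.1⟩)]
  refine Finset.sum_congr rfl fun p hp => ?_
  have h2 : ((parts hG).filter fun P => 2 ≤ P.card).filter (fun P => P.card = p) =
      (parts hG).filter fun P => P.card = p := by
    rw [Finset.filter_filter]
    refine Finset.filter_congr fun P _ => ?_
    have := (Finset.mem_Icc.1 hp).1
    omega
  rw [h2, numParts_eq, Finset.sum_congr rfl
    (fun P hP => by rw [(Finset.mem_filter.1 hP).2]), Finset.sum_const, nsmul_eq_mul, mul_comm]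

/-- The excesses of max(p - i, 1) over 1 are p - 2, p - 3, …, 0, with sum (p - 1)(p - 2)/2. -/
theorem two_mul_sum_max_le (p : ℕ) (hp : 1 ≤ p) (n : ℕ) :
    2 * ∑ i ∈ Finset.Ico 1 (n + 1), max ((p : ℤ) - i) 1 ≤ 2 * n + (p - 1) * (p - 2) := by
  -- The extra term is twice the excess not yet summed, which makes the induction go through.
  have key : 2 * ∑ i ∈ Finset.Ico 1 (n + 1), max ((p : ℤ) - i) 1 +
      (if n < p then ((p : ℤ) - 1 - n) * (p - 2 - n) else 0) ≤ 2 * n + (p - 1) * (p - 2) := by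
    induction n with
    | zero =>
      rw [if_pos (by omega)]
      simp
    | succ n ih =>
      rw [Finset.sum_Ico_succ_top (by omega)]
      by_cases h1 : n + 1 < p
      · rw [if_pos (by omega)] at ih
        rw [if_pos h1, max_eq_left (by omega)]
        push_cast
        linarith
      · rw [if_neg h1, max_eq_right (by omega)]
        have : 0 ≤ (if n < p then ((p : ℤ) - 1 - n) * (p - 2 - n) else 0) := by
          split_ifs with h2
          · have : (p : ℤ) - 1 - n = 0 := by omega
            simp [this]
          · exact le_rfl
        push_cast
        linarith
  have : 0 ≤ (if n < p then ((p : ℤ) - 1 - n) * (p - 2 - n) else 0) := by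
    split_ifs with h
    · rcases Nat.lt_or_ge (n + 1) p with h1 | h1
      · exact mul_nonneg (by omega) (by omega)
      · have : (p : ℤ) - 1 - n = 0 := by omega
        simp [this]
    · exact le_rfl
  linarith

/-- The initial position of the game on a complete multipartite graph is safe. -/
theorem onlineChoosable_card_parts [DecidableEq V]
    (hk : ∑ P ∈ (parts hG).filter (fun P => 2 ≤ P.card), ((P.card : ℤ) - 1) * (P.card - 2) ≤
      2 * numParts hG 1) :
    OnlineChoosable G (fun _ => (parts hG).card) := by
  set 𝓟 := (parts hG).filter fun P => 2 ≤ P.card with h𝓟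
  set N := Fintype.card V
  -- Class |V| is large enough that `width` there is |𝓟|; the singleton parts then need at most |𝓟|
  -- + k_1 = K tokens.
  set S : Finset (V × ℕ × ℕ) :=
    (Finset.univ.filter fun v => {v} ∈ parts hG).image fun v => (v, N, 0) with hS
  have hScard : S.card ≤ numParts hG 1 := by
    rw [numParts_eq]
    refine Finset.card_image_le.trans (Finset.card_le_card_of_injOn (fun v => {v}) ?_ ?_)
    · intro v hv
      have : {v} ∈ parts hG := by simpa using hv
      simp [this]
    · exact fun v _ w _ h => Finset.singleton_injective h
  have hcard := card_parts_filter_add_numParts_one hG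
  rw [← h𝓟] at hcard
  refine onlineChoosable_of_safe (𝓟 := 𝓟) (S := S) ⟨?_, ?_, ?_, ?_⟩
  · intro v _
    obtain ⟨P, hP, hvP⟩ := exists_mem_parts hG v
    by_cases h2 : 2 ≤ P.card
    · exact Or.inl ⟨P, Finset.mem_filter.2 ⟨hP, h2⟩, hvP⟩
    · have h1 : P.card = 1 := by
        have := (nonempty_of_mem_parts hG hP).card_pos
        omega
      obtain ⟨w, rfl⟩ := Finset.card_eq_one.1 h1
      rw [Finset.mem_singleton] at hvP
      subst hvP
      exact Or.inr ⟨(v, N, 0), Finset.mem_image_of_mem _ (by simpa using hP), rfl⟩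
  · exact fun P hP => isIndepSet_of_mem_parts hG (Finset.mem_filter.1 hP).1
  · intro P _ T _ hne
    obtain ⟨n, hn⟩ : ∃ n, T.card = n + 1 := ⟨T.card - 1, by have := hne.card_pos; omega⟩
    -- Together with `hk`, the widths sum to at most n|𝓟| + k_1, hence `demand` at n + 1 is at most
    -- (n + 1)K.
    have h1 : 2 * ∑ i ∈ Finset.Ico 1 (n + 1), width 𝓟 i ≤
        ∑ P ∈ 𝓟, (2 * (n : ℤ) + (P.card - 1) * (P.card - 2)) := by
      unfold width
      rw [Finset.sum_comm, Finset.mul_sum]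
      refine Finset.sum_le_sum fun P hP => two_mul_sum_max_le _ ?_ n
      exact (Finset.mem_filter.1 hP).2.trans' (by omega)
    rw [Finset.sum_add_distrib, Finset.sum_const, nsmul_eq_mul] at h1
    have h2 : ∑ i ∈ Finset.Ico 1 (n + 1), countAbove S i ≤ n * numParts hG 1 := by
      have : ∀ i ∈ Finset.Ico 1 (n + 1), countAbove S i ≤ numParts hG 1 := fun i _ => by
        unfold countAbove
        exact_mod_cast (Finset.card_filter_le _ _).trans hScard
      simpa using Finset.sum_le_card_nsmul _ _ _ this
    have h3 : ((parts hG).card : ℤ) = 𝓟.card + numParts hG 1 := by exact_mod_cast hcard.symm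
    rw [hn]
    unfold demand slope
    rw [Finset.sum_add_distrib, Finset.sum_const, hn, nsmul_eq_mul]
    push_cast
    rw [h3]
    linarith
  · intro s hs
    have h1 := countBefore_le_countAbove S s
    have h2 : countAbove S s.2.1 ≤ numParts hG 1 := by
      unfold countAbove
      exact_mod_cast (Finset.card_filter_le _ _).trans hScard
    obtain ⟨v, -, rfl⟩ := Finset.mem_image.1 hs
    rw [width_eq_card fun P _ => (Finset.card_le_univ P).trans (Nat.le_succ _)]
    dsimp only at h1 h2 ⊢
    omega

end Multipartite

end OnlineColoring

theorem mainTheorem2 {V : Type*} [Fintype V] [DecidableEq V] (G : SimpleGraph V)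
    (hG : G.IsCompleteMultipartite) (m : ℕ) (hm : G.indepNum = m) (hm2 : 2 ≤ m)
    (hk : 0 ≤ (OnlineColoring.numParts hG 1 : ℝ) -
      ∑ p ∈ Finset.Icc 2 m,
        ((p : ℝ) ^ 2 / 2 - 3 * (p : ℝ) / 2 + 1) * (OnlineColoring.numParts hG p : ℝ)) :
    OnlineColoring.OnlineChromaticChoosable G := by
  open OnlineColoring in
  have hsize : ∀ P ∈ parts hG, P.card ≤ m := fun P hP =>
    hm ▸ (isIndepSet_of_mem_parts hG hP).card_le_indepNum
  have hch : OnlineChoosable G (fun _ => (parts hG).card) := by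
    refine onlineChoosable_card_parts hG ?_
    rw [← sum_parts_filter hG hsize fun p => (p : ℝ) ^ 2 / 2 - 3 * (p : ℝ) / 2 + 1] at hk
    -- The coefficient p²/2 - 3p/2 + 1 equals (p - 1)(p - 2)/2.
    have h2 : ∑ P ∈ (parts hG).filter (fun P => 2 ≤ P.card),
        ((P.card : ℝ) - 1) * (P.card - 2) =
        2 * ∑ P ∈ (parts hG).filter (fun P => 2 ≤ P.card),
          ((P.card : ℝ) ^ 2 / 2 - 3 * (P.card : ℝ) / 2 + 1) := by
      rw [Finset.mul_sum]
      exact Finset.sum_congr rfl fun P _ => by ring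
    have h3 : ∑ P ∈ (parts hG).filter (fun P => 2 ≤ P.card),
        ((P.card : ℝ) - 1) * (P.card - 2) ≤ 2 * numParts hG 1 := by linarith
    exact_mod_cast h3
  refine le_antisymm ?_ (le_iInf₂ fun k hk => hk.colorable.chromaticNumber_le)
  refine (iInf₂_le (f := fun (k : ℕ) _ => (k : ℕ∞)) _ hch).trans ?_
  exact SimpleGraph.le_chromaticNumber_iff_colorable.2 fun n hn => by
    exact_mod_cast card_parts_le_of_colorable hG hn
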